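/- Let $\zeta_1,\zeta_2,\dots$ be i.i.d. real random variables, let $\widehat\gamma\in\mathbb R\setminus\{0\}$, and put $m(x)=E(\zeta_1;|\zeta_1|\le x)=E(\zeta_1 1_{\{|\zeta_1|\le x\}})$. Then there exists a real sequence $(a_n)$ with $a_n\to\infty$ such that $$\frac{1}{a_n}\sum_{i=1}^n\zeta_i\to\widehat\gamma\quad\text{in probability as } n\to\infty \qquad (\ast)$$ if and only if $m(x)/\widehat\gamma>0$ for all sufficiently large $x$ and $xP(|\zeta_1|>x)/m(x)\to0$ as $x\to\infty$. Moreover, every real sequence $(a_n)$ with $a_n\to\infty$ that satisfies $(\ast)$ also satisfies $a_n/m(a_n)\sim n/\widehat\gamma$ as $n\to\infty$ (that is, the ratio of the two sides tends to $1$). -/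

import Mathlib

open Filter Topology MeasureTheory ProbabilityTheory Asymptotics

/-- The truncated mean `m(x) = E(X ; |X| ≤ x)` of a real random variable `X`. -/
noncomputable def truncatedMean {Ω : Type*} [MeasurableSpace Ω] (μ : Measure Ω) (X : Ω → ℝ)
    (x : ℝ) : ℝ :=
  ∫ ω in {ω | |X ω| ≤ x}, X ω ∂μ

/-- `(ζ_1 + ⋯ + ζ_n) / a_n → γ` in probability, with `a_n → ∞`, as `n → ∞`.
The variables are indexed from `0`, so that `ζ 0, …, ζ (n - 1)` are the first `n` of them. -/
def ScaledSumsTendsto {Ω : Type*} [MeasurableSpace Ω] (μ : Measure Ω) (ζ : ℕ → Ω → ℝ)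
    (a : ℕ → ℝ) (γ : ℝ) : Prop :=
  Tendsto a atTop atTop ∧
    TendstoInMeasure μ (fun n ω => (∑ i ∈ Finset.range n, ζ i ω) / a n) atTop (fun _ => γ)

/-! The proof compares the tail `P(|ζ| > x)`, the truncated mean `m` and the truncated second moment
`V(x) = E(ζ² ; |ζ| ≤ x)` at the scale of the norming constants. The link is the criterion for
degenerate convergence: `(ζ_1 + ⋯ + ζ_n) / a_n → γ` in probability exactly when
`n P(|ζ| > a_n) → 0`, `n V(a_n) / a_n² → 0` and `n m(a_n) / a_n → γ`.

*Sufficiency.* Since `|m(y) - m(x)| ≤ y P(|ζ| > x)` for `x ≤ y`, a tail that is negligible against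
`m(x) / x` makes `m` slowly varying (`eventually_abs_truncatedMean_sub_le`). Doubling the argument
then contracts both `m(x) / x` and `V(x) / (x m(x))` by a factor below one, up to an error tending
to zero, so both tend to zero (`tendsto_zero_of_doubling`). Hence `a / m(a) = n / γ` has asymptotic
solutions `a_n → ∞` (`exists_norming_seq`), along which the three conditions hold, and Chebyshev's
inequality for the variables truncated at `a_n` gives the weak law
(`measureReal_le_abs_sum_sub_le`).

*Necessity.* Let `φ` be the characteristic function of `ζ`. Convergence in probability gives
`φ(t / a_n)^n → exp(iγt)` uniformly for `|t| ≤ 2`, and uniformity allows logarithms to be taken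
along a continuous branch, so that `n (φ(t / a_n) - 1) → iγt` uniformly
(`eventually_norm_mul_sub_one_sub_le`). Integrating over `[-2, 2]` bounds `n P(|ζ| > a_n)`; at
`t = 1` the real part bounds `n V(a_n) / a_n²`, because `1 - cos x` dominates a multiple of `x²` on
`[-1, 1]`, and the imaginary part `n E sin(ζ / a_n)` then differs from `n m(a_n) / a_n` by a
vanishing amount. The last of these limits is the asymptotic equivalence
`a_n / m(a_n) ~ n / γ`, and the quotient of the first by the last is the tail condition along the
sequence `a_n`. As `a_{n+1} ≤ 2 a_n` eventually (`ScaledSumsTendsto.eventually_succ_le`), the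
condition extends from this sequence to all real `x → ∞`. -/

/-! ### Truncated moments -/

/-- The truncated second moment `E(X² ; |X| ≤ x)` of a real random variable `X`. -/
noncomputable def truncatedSecondMoment {Ω : Type*} [MeasurableSpace Ω] (μ : Measure Ω)
    (X : Ω → ℝ) (x : ℝ) : ℝ :=
  ∫ ω in {ω | |X ω| ≤ x}, X ω ^ 2 ∂μ

lemma truncatedSecondMoment_nonneg {Ω : Type*} [MeasurableSpace Ω] {μ : Measure Ω} (X : Ω → ℝ)
    (x : ℝ) : 0 ≤ truncatedSecondMoment μ X x :=
  integral_nonneg fun _ => sq_nonneg _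

section TruncatedMoments

variable {Ω : Type*} [MeasurableSpace Ω] {μ : Measure Ω} [IsProbabilityMeasure μ] {X : Ω → ℝ}

lemma measurableSet_abs_le (hX : Measurable X) (x : ℝ) : MeasurableSet {ω | |X ω| ≤ x} :=
  measurableSet_le (by fun_prop) measurable_const

lemma measurableSet_lt_abs (hX : Measurable X) (x : ℝ) : MeasurableSet {ω | x < |X ω|} :=
  measurableSet_lt measurable_const (by fun_prop)

lemma integrableOn_abs_le (hX : Measurable X) (x : ℝ) :
    IntegrableOn X {ω | |X ω| ≤ x} μ :=
  Measure.integrableOn_of_bounded (M := x) (measure_ne_top _ _) hX.aestronglyMeasurable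
    ((ae_restrict_iff' (measurableSet_abs_le hX x)).2 (.of_forall fun _ h => h))

lemma integrableOn_sq_abs_le (hX : Measurable X) (x : ℝ) :
    IntegrableOn (fun ω => X ω ^ 2) {ω | |X ω| ≤ x} μ :=
  Measure.integrableOn_of_bounded (M := x ^ 2) (measure_ne_top _ _)
    (hX.pow_const 2).aestronglyMeasurable
    ((ae_restrict_iff' (measurableSet_abs_le hX x)).2 (.of_forall fun ω (h : |X ω| ≤ x) => by
      rw [Real.norm_eq_abs, abs_pow]
      exact pow_le_pow_left₀ (abs_nonneg _) h 2))

lemma abs_truncatedMean_le (X : Ω → ℝ) {x : ℝ} (hx : 0 ≤ x) : |truncatedMean μ X x| ≤ x := by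
  have h := norm_setIntegral_le_of_norm_le_const (μ := μ) (s := {ω | |X ω| ≤ x}) (f := X) (C := x)
    (measure_lt_top _ _) (fun _ h => h)
  exact h.trans (mul_le_of_le_one_right hx measureReal_le_one)

lemma truncatedSecondMoment_le (X : Ω → ℝ) (x : ℝ) : truncatedSecondMoment μ X x ≤ x ^ 2 := by
  have h := norm_setIntegral_le_of_norm_le_const (μ := μ) (s := {ω | |X ω| ≤ x})
    (f := fun ω => X ω ^ 2) (C := x ^ 2)
    (measure_lt_top _ _) (fun ω (h : |X ω| ≤ x) => by
      rw [Real.norm_eq_abs, abs_pow]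
      exact pow_le_pow_left₀ (abs_nonneg _) h 2)
  exact (le_abs_self _).trans (h.trans (mul_le_of_le_one_right (sq_nonneg x) measureReal_le_one))

/-- The values of `X` in the shell `x < |X| ≤ y` are at most `y` in absolute value. -/
lemma abs_truncatedMean_sub_le (hX : Measurable X) {x y : ℝ} (hx : 0 ≤ x) (hxy : x ≤ y) :
    |truncatedMean μ X y - truncatedMean μ X x| ≤ y * μ.real {ω | x < |X ω|} := by
  have hsub : {ω | |X ω| ≤ x} ⊆ {ω | |X ω| ≤ y} := fun ω (h : |X ω| ≤ x) => h.trans hxy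
  rw [truncatedMean, truncatedMean, ← setIntegral_sdiff (measurableSet_abs_le hX x)
    (integrableOn_abs_le hX y) hsub]
  have h := norm_setIntegral_le_of_norm_le_const (μ := μ)
    (s := {ω | |X ω| ≤ y} \ {ω | |X ω| ≤ x}) (f := X) (C := y)
    (measure_lt_top _ _) (fun ω h => h.1)
  refine h.trans (mul_le_mul_of_nonneg_left (measureReal_mono fun ω h => ?_) (hx.trans hxy))
  exact not_le.1 (show ¬ |X ω| ≤ x from h.2)

lemma truncatedSecondMoment_le_add (hX : Measurable X) {x y : ℝ} (hxy : x ≤ y) :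
    truncatedSecondMoment μ X y ≤
      truncatedSecondMoment μ X x + y ^ 2 * μ.real {ω | x < |X ω|} := by
  have hsub : {ω | |X ω| ≤ x} ⊆ {ω | |X ω| ≤ y} := fun ω (h : |X ω| ≤ x) => h.trans hxy
  rw [← sub_le_iff_le_add', truncatedSecondMoment, truncatedSecondMoment,
    ← setIntegral_sdiff (measurableSet_abs_le hX x) (integrableOn_sq_abs_le hX y) hsub]
  have h := norm_setIntegral_le_of_norm_le_const (μ := μ)
    (s := {ω | |X ω| ≤ y} \ {ω | |X ω| ≤ x}) (f := fun ω => X ω ^ 2) (C := y ^ 2)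
    (measure_lt_top _ _) (fun ω h => by
      rw [Real.norm_eq_abs, abs_pow]
      exact pow_le_pow_left₀ (abs_nonneg _) h.1 2)
  refine (le_abs_self _).trans (h.trans
    (mul_le_mul_of_nonneg_left (measureReal_mono fun ω h => ?_) (sq_nonneg y)))
  exact not_le.1 (show ¬ |X ω| ≤ x from h.2)

end TruncatedMoments

/-! ### Slow variation of the truncated mean -/

/-- A nonnegative, locally bounded function that contracts by the factor `3/4` whenever the
argument doubles, up to an error tending to zero, tends to zero at infinity. -/
lemma tendsto_zero_of_doubling {W η : ℝ → ℝ} {X₀ : ℝ} (hX₀ : 0 < X₀)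
    (hW : ∀ x, X₀ ≤ x → 0 ≤ W x)
    (hbdd : ∀ Y, X₀ ≤ Y → ∃ C, ∀ y ∈ Set.Icc Y (2 * Y), W y ≤ C)
    (hrec : ∀ x, X₀ ≤ x → W (2 * x) ≤ 3 / 4 * W x + η x)
    (hη : Tendsto η atTop (𝓝 0)) : Tendsto W atTop (𝓝 0) := by
  rw [Metric.tendsto_atTop]
  intro ε hε
  obtain ⟨Y, hY⟩ := eventually_atTop.1
    ((hη.eventually_lt_const (show (0 : ℝ) < ε / 8 by positivity)).and
      (eventually_ge_atTop X₀))
  have hYX : X₀ ≤ Y := (hY Y le_rfl).2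
  have hYpos : 0 < Y := hX₀.trans_le hYX
  obtain ⟨C, hC⟩ := hbdd Y hYX
  -- `ε / 2` is the fixed point of `w ↦ 3 / 4 * w + ε / 8`.
  have key : ∀ k : ℕ, ∀ y ∈ Set.Icc Y (2 * Y), W (2 ^ k * y) ≤ (3 / 4) ^ k * |C| + ε / 2 := by
    intro k
    induction k with
    | zero =>
      intro y hy
      have := hC y hy
      have := le_abs_self C
      simp only [pow_zero, one_mul]
      linarith
    | succ k ih =>
      intro y hy
      have h1 : Y ≤ 2 ^ k * y := hy.1.trans (le_mul_of_one_le_left (hYpos.le.trans hy.1)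
        (one_le_pow₀ (by norm_num)))
      have h2 := hrec _ (hYX.trans h1)
      have h3 := (hY _ h1).1
      have h4 := ih y hy
      rw [pow_succ', mul_assoc, pow_succ']
      linarith
  have hlim : Tendsto (fun k : ℕ => (3 / 4 : ℝ) ^ k * |C|) atTop (𝓝 0) := by
    simpa using (tendsto_pow_atTop_nhds_zero_of_lt_one (r := (3 / 4 : ℝ)) (by norm_num)
      (by norm_num)).mul_const |C|
  obtain ⟨K, hK⟩ := eventually_atTop.1
    (hlim.eventually_lt_const (show (0 : ℝ) < ε / 2 by positivity))
  refine ⟨2 ^ K * Y, fun x hx => ?_⟩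
  have hxY : Y ≤ x := le_trans (le_mul_of_one_le_left hYpos.le (one_le_pow₀ (by norm_num))) hx
  obtain ⟨k, hk1, hk2⟩ := exists_nat_pow_near (x := x / Y) (y := 2) ((one_le_div hYpos).2 hxY)
    (by norm_num)
  rw [le_div_iff₀ hYpos] at hk1
  rw [div_lt_iff₀ hYpos] at hk2
  have hKk : K ≤ k := by
    have : (2 : ℝ) ^ K < 2 ^ (k + 1) := lt_of_mul_lt_mul_right (hx.trans_lt hk2) hYpos.le
    have := (pow_lt_pow_iff_right₀ (by norm_num : (1 : ℝ) < 2)).1 this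
    omega
  have hpos : (0 : ℝ) < 2 ^ k := by positivity
  have h := key k (x / 2 ^ k) ⟨by rw [le_div_iff₀ hpos]; linarith,
    by rw [div_le_iff₀ hpos]; rw [pow_succ] at hk2; linarith⟩
  rw [mul_div_cancel₀ _ hpos.ne'] at h
  have := hK k hKk
  rw [Real.dist_eq, sub_zero, abs_of_nonneg (hW x (hYX.trans hxY))]
  linarith

section RegularVariation

variable {Ω : Type*} [MeasurableSpace Ω] {μ : Measure Ω} [IsProbabilityMeasure μ] {X : Ω → ℝ}
  {γ : ℝ}

/-- The truncated mean is slowly varying, uniformly over `[x, 2x]`, once the tail is negligible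
compared with it. -/
lemma eventually_abs_truncatedMean_sub_le (hX : Measurable X)
    (hpos : ∀ᶠ x : ℝ in atTop, 0 < truncatedMean μ X x / γ)
    (htail : Tendsto (fun x : ℝ => x * μ.real {ω | x < |X ω|} / truncatedMean μ X x)
      atTop (𝓝 0)) {δ : ℝ} (hδ : 0 < δ) :
    ∀ᶠ x : ℝ in atTop, ∀ y ∈ Set.Icc x (2 * x),
      |truncatedMean μ X y / γ - truncatedMean μ X x / γ| ≤ δ * (truncatedMean μ X x / γ) := by
  have h0 := htail.abs.eventually_lt_const (show |(0 : ℝ)| < δ / 2 by simpa using hδ)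
  filter_upwards [hpos, h0, eventually_gt_atTop 0] with x hx hlt hx0 y hy
  have hm : truncatedMean μ X x ≠ 0 := by rintro h; simp [h] at hx
  have hγ : γ ≠ 0 := by rintro rfl; simp at hx
  have habs : |truncatedMean μ X x| / |γ| = truncatedMean μ X x / γ := by
    rw [← abs_div, abs_of_pos hx]
  have h1 := abs_truncatedMean_sub_le (μ := μ) hX hx0.le hy.1
  rw [abs_div, div_lt_iff₀ (abs_pos.2 hm)] at hlt
  rw [← sub_div, abs_div, ← habs, ← mul_div_assoc]
  refine div_le_div_of_nonneg_right (h1.trans ?_) (abs_nonneg γ)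
  have h2 := le_abs_self (x * μ.real {ω | x < |X ω|})
  have h3 := mul_le_mul_of_nonneg_right hy.2 (measureReal_nonneg (μ := μ) (s := {ω | x < |X ω|}))
  linarith

lemma tendsto_truncatedMean_div (hX : Measurable X)
    (hpos : ∀ᶠ x : ℝ in atTop, 0 < truncatedMean μ X x / γ)
    (htail : Tendsto (fun x : ℝ => x * μ.real {ω | x < |X ω|} / truncatedMean μ X x)
      atTop (𝓝 0)) :
    Tendsto (fun x : ℝ => truncatedMean μ X x / γ / x) atTop (𝓝 0) := by
  obtain ⟨X₀, h⟩ := eventually_atTop.1 (hpos.and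
    ((eventually_abs_truncatedMean_sub_le hX hpos htail (δ := 1 / 2) (by norm_num)).and
      (eventually_gt_atTop 0)))
  refine tendsto_zero_of_doubling (η := fun _ => 0) (h X₀ le_rfl).2.2
    (fun x hx => (div_pos (h x hx).1 (h x hx).2.2).le) (fun Y hY => ⟨1 / |γ|, fun y hy => ?_⟩)
    (fun x hx => ?_) tendsto_const_nhds
  · have hy0 := (h y (hY.trans hy.1)).2.2
    rw [div_div, mul_comm, ← div_div]
    refine (le_abs_self _).trans ?_
    rw [abs_div, abs_div, abs_of_pos hy0]
    exact div_le_div_of_nonneg_right ((div_le_one hy0).2 (abs_truncatedMean_le X hy0.le))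
      (abs_nonneg γ)
  · obtain ⟨hp, hs, hx0⟩ := h x hx
    have h1 := (abs_le.1 (hs (2 * x) ⟨by linarith, le_rfl⟩)).2
    rw [add_zero, ← mul_div_assoc, div_le_div_iff₀ (by positivity) hx0]
    nlinarith

/-- If the tail is negligible compared with the truncated mean, then so is the truncated second
moment, at the scale at which the weak law needs it. -/
lemma tendsto_truncatedSecondMoment_div (hX : Measurable X)
    (hpos : ∀ᶠ x : ℝ in atTop, 0 < truncatedMean μ X x / γ)
    (htail : Tendsto (fun x : ℝ => x * μ.real {ω | x < |X ω|} / truncatedMean μ X x)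
      atTop (𝓝 0)) :
    Tendsto (fun x : ℝ => truncatedSecondMoment μ X x / (x * (truncatedMean μ X x / γ)))
      atTop (𝓝 0) := by
  obtain ⟨X₀, h⟩ := eventually_atTop.1 (hpos.and
    ((eventually_abs_truncatedMean_sub_le hX hpos htail (δ := 1 / 3) (by norm_num)).and
      (eventually_gt_atTop 0)))
  have hη : Tendsto (fun x : ℝ => 3 * (γ * (x * μ.real {ω | x < |X ω|} / truncatedMean μ X x)))
      atTop (𝓝 0) := by simpa using (htail.const_mul γ).const_mul 3
  refine tendsto_zero_of_doubling (h X₀ le_rfl).2.2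
    (fun x hx => div_nonneg (truncatedSecondMoment_nonneg X x)
      (mul_pos (h x hx).2.2 (h x hx).1).le)
    (fun Y hY => ⟨(2 * Y) ^ 2 / (Y * (2 / 3 * (truncatedMean μ X Y / γ))), fun y hy => ?_⟩)
    (fun x hx => ?_) hη
  · obtain ⟨hp, hs, hY0⟩ := h Y hY
    have h1 := (abs_le.1 (hs y hy)).1
    refine div_le_div₀ (by positivity) ((truncatedSecondMoment_le X y).trans
      (pow_le_pow_left₀ (hY0.le.trans hy.1) hy.2 2)) (by positivity) ?_
    exact mul_le_mul hy.1 (by linarith) (by positivity) (hY0.le.trans hy.1)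
  · obtain ⟨hp, hs, hx0⟩ := h x hx
    have hγ : γ ≠ 0 := by rintro rfl; simp at hp
    have h1 := (abs_le.1 (hs (2 * x) ⟨by linarith, le_rfl⟩)).1
    have h2 := truncatedSecondMoment_le_add (μ := μ) hX (show x ≤ 2 * x by linarith)
    have h3 := truncatedSecondMoment_nonneg (μ := μ) X (2 * x)
    have h4 : (truncatedMean μ X x / γ) * (2 / 3) ≤ truncatedMean μ X (2 * x) / γ := by linarith
    have h5 : γ * (x * μ.real {ω | x < |X ω|} / truncatedMean μ X x) =
        x * μ.real {ω | x < |X ω|} / (truncatedMean μ X x / γ) := by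
      rw [div_div_eq_mul_div]; ring
    rw [h5]
    generalize truncatedMean μ X x / γ = M at *
    calc _ ≤ truncatedSecondMoment μ X (2 * x) / (2 * x * (M * (2 / 3))) :=
          div_le_div_of_nonneg_left h3 (by positivity) (by gcongr)
      _ ≤ (truncatedSecondMoment μ X x + (2 * x) ^ 2 * μ.real {ω | x < |X ω|}) /
          (2 * x * (M * (2 / 3))) := by gcongr
      _ = _ := by field_simp; ring

end RegularVariation

/-! ### The weak law for truncated sums -/

section WeakLaw

variable {Ω : Type*} [MeasurableSpace Ω] {μ : Measure Ω} [IsProbabilityMeasure μ] {ζ : ℕ → Ω → ℝ}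

/-- Chebyshev's inequality for the sum of the variables truncated at level `a`, together with the
union bound for the event that some variable exceeds this level. -/
lemma measureReal_le_abs_sum_sub_le (hmeas : ∀ i, Measurable (ζ i)) (hindep : iIndepFun ζ μ)
    (hident : ∀ i, IdentDistrib (ζ i) (ζ 0) μ μ) (n : ℕ) (a : ℝ) {c : ℝ} (hc : 0 < c) :
    μ.real {ω | c ≤ |∑ i ∈ Finset.range n, ζ i ω - n * truncatedMean μ (ζ 0) a|} ≤
      n * μ.real {ω | a < |ζ 0 ω|} + n * truncatedSecondMoment μ (ζ 0) a / c ^ 2 := by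
  set g : ℝ → ℝ := Set.indicator {x | |x| ≤ a} id with hg
  have hgm : Measurable g := measurable_id.indicator
    (measurableSet_le (by fun_prop) measurable_const)
  have hgle : ∀ x, |g x| ≤ |a| := by
    intro x
    by_cases hx : |x| ≤ a
    · rw [hg, Set.indicator_of_mem (show x ∈ {x | |x| ≤ a} from hx)]
      exact hx.trans (le_abs_self a)
    · rw [hg, Set.indicator_of_notMem (show x ∉ {x | |x| ≤ a} from hx), abs_zero]
      exact abs_nonneg a
  have hYm : ∀ i, Measurable (g ∘ ζ i) := fun i => hgm.comp (hmeas i)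
  have hL2 : ∀ i, MemLp (g ∘ ζ i) 2 μ := fun i =>
    MemLp.of_bound (hYm i).aestronglyMeasurable |a| (.of_forall fun ω => hgle _)
  have hid : ∀ i, IdentDistrib (g ∘ ζ i) (g ∘ ζ 0) μ μ := fun i => (hident i).comp hgm
  have hcomp : g ∘ ζ 0 = Set.indicator {ω | |ζ 0 ω| ≤ a} (ζ 0) := by
    ext ω; simp [hg, Set.indicator_apply]
  have hmean : μ[g ∘ ζ 0] = truncatedMean μ (ζ 0) a := by
    rw [hcomp, integral_indicator (measurableSet_abs_le (hmeas 0) a), truncatedMean]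
  have hsq : μ[(g ∘ ζ 0) ^ 2] = truncatedSecondMoment μ (ζ 0) a := by
    rw [truncatedSecondMoment, ← integral_indicator (measurableSet_abs_le (hmeas 0) a)]
    congr 1
    ext ω
    rw [hcomp]
    by_cases h : |ζ 0 ω| ≤ a <;> simp [h]
  have hvar : variance (∑ i ∈ Finset.range n, g ∘ ζ i) μ ≤
      n * truncatedSecondMoment μ (ζ 0) a := by
    rw [IndepFun.variance_sum (fun i _ => hL2 i)
      (fun i _ j _ hij => (hindep.indepFun hij).comp hgm hgm),
      Finset.sum_congr rfl (fun i _ => (hid i).variance_eq), Finset.sum_const, Finset.card_range,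
      nsmul_eq_mul, ← hsq]
    exact mul_le_mul_of_nonneg_left (variance_le_expectation_sq (hYm 0).aestronglyMeasurable)
      n.cast_nonneg
  have hexp : μ[∑ i ∈ Finset.range n, g ∘ ζ i] = n * truncatedMean μ (ζ 0) a := by
    simp only [Finset.sum_apply]
    rw [integral_finsetSum _ fun i _ => (hL2 i).integrable one_le_two,
      Finset.sum_congr rfl (fun i _ => (hid i).integral_eq), Finset.sum_const, Finset.card_range,
      nsmul_eq_mul, hmean]
  have hcheb : μ.real {ω | c ≤ |(∑ i ∈ Finset.range n, g ∘ ζ i) ω -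
      n * truncatedMean μ (ζ 0) a|} ≤ n * truncatedSecondMoment μ (ζ 0) a / c ^ 2 := by
    have h := meas_ge_le_variance_div_sq (μ := μ) (memLp_finsetSum' (Finset.range n)
      (fun i _ => hL2 i)) hc
    rw [hexp] at h
    refine (ENNReal.toReal_mono ENNReal.ofReal_ne_top h).trans ?_
    rw [ENNReal.toReal_ofReal (div_nonneg (variance_nonneg _ _) (sq_nonneg c))]
    gcongr
  have hunion : μ.real (⋃ i ∈ Finset.range n, {ω | a < |ζ i ω|}) ≤
      n * μ.real {ω | a < |ζ 0 ω|} := by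
    refine (measureReal_biUnion_finset_le _ _).trans (le_of_eq ?_)
    rw [← nsmul_eq_mul, ← Finset.card_range n, ← Finset.sum_const, Finset.card_range]
    refine Finset.sum_congr rfl fun i _ => ?_
    exact congrArg ENNReal.toReal ((hident i).measure_mem_eq (s := {x : ℝ | a < |x|})
      (measurableSet_lt measurable_const (by fun_prop)))
  refine (measureReal_mono ?_).trans ((measureReal_union_le _ _).trans (add_le_add hunion hcheb))
  intro ω hω
  by_cases h : ω ∈ ⋃ i ∈ Finset.range n, {ω | a < |ζ i ω|}
  · exact Or.inl h
  · refine Or.inr ?_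
    simp only [Set.mem_iUnion, not_exists, Set.mem_ofPred_eq, not_lt] at h
    have hs : (∑ i ∈ Finset.range n, g ∘ ζ i) ω = ∑ i ∈ Finset.range n, ζ i ω := by
      rw [Finset.sum_apply]
      exact Finset.sum_congr rfl fun i hi => Set.indicator_of_mem
        (show ζ i ω ∈ {x | |x| ≤ a} from h i hi) _
    simpa only [Set.mem_ofPred_eq, hs] using hω

/-- The three conditions of the degenerate convergence criterion imply the weak law. -/
lemma scaledSumsTendsto_of_truncated (hmeas : ∀ i, Measurable (ζ i)) (hindep : iIndepFun ζ μ)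
    (hident : ∀ i, IdentDistrib (ζ i) (ζ 0) μ μ) {a : ℕ → ℝ} {γ : ℝ} (ha : Tendsto a atTop atTop)
    (htail : Tendsto (fun n : ℕ => n * μ.real {ω | a n < |ζ 0 ω|}) atTop (𝓝 0))
    (hsq : Tendsto (fun n : ℕ => n * truncatedSecondMoment μ (ζ 0) (a n) / a n ^ 2) atTop (𝓝 0))
    (hmean : Tendsto (fun n : ℕ => n * truncatedMean μ (ζ 0) (a n) / a n) atTop (𝓝 γ)) :
    ScaledSumsTendsto μ ζ a γ := by
  refine ⟨ha, tendstoInMeasure_iff_measureReal_norm.2 fun ε hε => ?_⟩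
  have hlim : Tendsto (fun n : ℕ => n * μ.real {ω | a n < |ζ 0 ω|} +
      n * truncatedSecondMoment μ (ζ 0) (a n) / a n ^ 2 / (ε / 2) ^ 2) atTop (𝓝 0) := by
    simpa using htail.add (hsq.div_const ((ε / 2) ^ 2))
  refine squeeze_zero' (.of_forall fun n => measureReal_nonneg) ?_ hlim
  filter_upwards [ha.eventually_gt_atTop 0,
    hmean (Metric.ball_mem_nhds γ (half_pos hε))] with n hn hm
  rw [Set.mem_preimage, Metric.mem_ball, Real.dist_eq] at hm
  have h := measureReal_le_abs_sum_sub_le hmeas hindep hident n (a n)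
    (show 0 < a n * (ε / 2) by positivity)
  rw [mul_pow, ← div_div] at h
  refine (measureReal_mono fun ω hω => ?_).trans h
  simp only [Set.mem_ofPred_eq, Real.norm_eq_abs] at hω ⊢
  rw [mul_comm, ← le_div_iff₀ hn]
  have h1 : |∑ i ∈ Finset.range n, ζ i ω - n * truncatedMean μ (ζ 0) (a n)| / a n =
      |(∑ i ∈ Finset.range n, ζ i ω) / a n - n * truncatedMean μ (ζ 0) (a n) / a n| := by
    rw [← sub_div, abs_div, abs_of_pos hn]
  rw [h1]
  have h2 := abs_sub_le ((∑ i ∈ Finset.range n, ζ i ω) / a n)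
    (n * truncatedMean μ (ζ 0) (a n) / a n) γ
  linarith

end WeakLaw

/-! ### Existence of norming constants -/

/-- A slowly varying positive function `M` with `M x = o(x)` admits norming constants, that is,
asymptotic solutions `a n` of `a / M a = n`. -/
lemma exists_norming_seq {M : ℝ → ℝ} (hpos : ∀ᶠ x in atTop, 0 < M x)
    (hslow : ∀ δ, 0 < δ → ∀ᶠ x in atTop, ∀ y ∈ Set.Icc x (2 * x), |M y - M x| ≤ δ * M x)
    (hsmall : Tendsto (fun x => M x / x) atTop (𝓝 0)) :
    ∃ a : ℕ → ℝ, Tendsto a atTop atTop ∧ Tendsto (fun n : ℕ => n * M (a n) / a n) atTop (𝓝 1) := by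
  obtain ⟨X₀, hX₀⟩ := eventually_atTop.1 (hpos.and (eventually_gt_atTop 0))
  have hX₀pos : 0 < X₀ := (hX₀ X₀ le_rfl).2
  -- Since `M` may jump, `a n` is a point just below the last `x` with `x / M x ≤ n`.
  let A : ℕ → Set ℝ := fun n => {x | X₀ ≤ x ∧ x ≤ n * M x}
  have hbdd : ∀ n, BddAbove (A n) := by
    intro n
    obtain ⟨B, hB⟩ := eventually_atTop.1
      ((hsmall.eventually_lt_const (show (0 : ℝ) < 1 / (n + 1) by positivity)).and
        (eventually_gt_atTop 0))
    refine ⟨B, fun x hx => le_of_not_gt fun hBx => ?_⟩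
    obtain ⟨h1, h2⟩ := hB x hBx.le
    rw [div_lt_div_iff₀ h2 (by positivity)] at h1
    have h3 := (hX₀ x hx.1).1
    have h4 := hx.2
    linarith
  have hmem : ∀ x, X₀ ≤ x → ∀ᶠ n : ℕ in atTop, x ∈ A n := by
    intro x hx
    filter_upwards [tendsto_natCast_atTop_atTop.eventually_ge_atTop (x / M x)] with n hn
    exact ⟨hx, (div_le_iff₀ (hX₀ x hx).1).1 hn⟩
  have hex : ∀ n : ℕ, ∃ x, (A n).Nonempty → x ∈ A n ∧ sSup (A n) < (1 + 1 / (n + 1)) * x := by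
    intro n
    by_cases hne : (A n).Nonempty
    · have hn : (1 : ℝ) < 1 + 1 / (n + 1) := lt_add_of_pos_right 1 (by positivity)
      have hs : 0 < sSup (A n) :=
        let ⟨x, hx⟩ := hne; hX₀pos.trans_le (hx.1.trans (le_csSup (hbdd n) hx))
      obtain ⟨x, hx, hlt⟩ := exists_lt_of_lt_csSup hne (div_lt_self hs hn)
      exact ⟨x, fun _ => ⟨hx, by rwa [div_lt_iff₀' (by positivity)] at hlt⟩⟩
    · exact ⟨0, fun h => absurd h hne⟩
  choose a ha using hex
  have hne : ∀ᶠ n in atTop, a n ∈ A n ∧ sSup (A n) < (1 + 1 / ((n : ℝ) + 1)) * a n := by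
    filter_upwards [hmem X₀ le_rfl] with n hn using ha n ⟨X₀, hn⟩
  have hle2 : ∀ n : ℕ, 1 + 1 / ((n : ℝ) + 1) ≤ 2 := fun n => by
    have : 1 / ((n : ℝ) + 1) ≤ 1 := (div_le_one (by positivity)).2 (by simp)
    linarith
  have htop : Tendsto a atTop atTop := by
    rw [tendsto_atTop]
    intro b
    filter_upwards [hne, hmem (max X₀ (2 * b)) (le_max_left _ _)] with n hn hb
    have h1 := (le_max_right X₀ (2 * b)).trans (le_csSup (hbdd n) hb)
    have h2 := mul_le_mul_of_nonneg_right (hle2 n) (hX₀pos.le.trans hn.1.1)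
    linarith [hn.2]
  refine ⟨a, htop, ?_⟩
  have hupper : ∀ δ : ℝ, 0 < δ → ∀ᶠ n : ℕ in atTop, (1 - δ) * (n * M (a n) / a n) < 1 + δ := by
    intro δ hδ
    filter_upwards [hne, htop.eventually (hslow δ hδ), htop.eventually_gt_atTop 0,
      (tendsto_one_div_add_atTop_nhds_zero_nat (𝕜 := ℝ)).eventually_lt_const hδ]
      with n hn hs hn0 hnδ
    have h1 : (1 : ℝ) ≤ 1 + 1 / ((n : ℝ) + 1) := le_add_of_nonneg_right (by positivity)
    set q : ℝ := 1 + 1 / ((n : ℝ) + 1) with hq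
    have hqa : a n ≤ q * a n := le_mul_of_one_le_left hn0.le h1
    have h2 := (abs_le.1 (hs (q * a n) ⟨hqa, mul_le_mul_of_nonneg_right (hle2 n) hn0.le⟩)).1
    have h3 : n * M (q * a n) < q * a n := by
      by_contra! hcon
      exact absurd (le_csSup (hbdd n) ⟨hn.1.1.trans hqa, hcon⟩) (not_le.2 hn.2)
    rw [← mul_div_assoc, div_lt_iff₀ hn0]
    have h4 : (n : ℝ) * ((1 - δ) * M (a n)) ≤ n * M (q * a n) :=
      mul_le_mul_of_nonneg_left (by linarith) n.cast_nonneg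
    have h5 : q * a n ≤ (1 + δ) * a n := mul_le_mul_of_nonneg_right (by linarith) hn0.le
    linarith
  rw [tendsto_order]
  constructor
  · intro b hb
    filter_upwards [hne, htop.eventually_gt_atTop 0] with n hn hn0
    exact hb.trans_le ((one_le_div hn0).2 hn.1.2)
  · intro b hb
    -- Chosen so that `(1 + δ) / (1 - δ) = b`.
    have hδ : 0 < (b - 1) / (b + 1) := div_pos (by linarith) (by linarith)
    filter_upwards [hupper _ hδ] with n hn
    have e1 : 1 - (b - 1) / (b + 1) = 2 / (b + 1) := by
      have : b + 1 ≠ 0 := by linarith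
      field_simp; ring
    have e2 : 1 + (b - 1) / (b + 1) = 2 / (b + 1) * b := by
      have : b + 1 ≠ 0 := by linarith
      field_simp; ring
    rw [e1, e2] at hn
    exact lt_of_mul_lt_mul_left hn (div_pos two_pos (by linarith)).le

/-- Sufficiency: a negligible tail relative to a truncated mean of the sign of `γ` gives norming
constants for the weak law. -/
lemma exists_scaledSumsTendsto {Ω : Type*} [MeasurableSpace Ω] {μ : Measure Ω}
    [IsProbabilityMeasure μ] {ζ : ℕ → Ω → ℝ} (hmeas : ∀ i, Measurable (ζ i))
    (hindep : iIndepFun ζ μ) (hident : ∀ i, IdentDistrib (ζ i) (ζ 0) μ μ) {γ : ℝ}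
    (hpos : ∀ᶠ x : ℝ in atTop, 0 < truncatedMean μ (ζ 0) x / γ)
    (htail : Tendsto (fun x : ℝ => x * μ.real {ω | x < |ζ 0 ω|} / truncatedMean μ (ζ 0) x)
      atTop (𝓝 0)) :
    ∃ a : ℕ → ℝ, ScaledSumsTendsto μ ζ a γ := by
  obtain ⟨a, ha, hlim⟩ := exists_norming_seq hpos
    (fun δ hδ => eventually_abs_truncatedMean_sub_le (hmeas 0) hpos htail hδ)
    (tendsto_truncatedMean_div (hmeas 0) hpos htail)
  have hev := (ha.eventually hpos).and (ha.eventually_gt_atTop 0)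
  refine ⟨a, scaledSumsTendsto_of_truncated hmeas hindep hident ha ?_ ?_ ?_⟩
  · have h := (hlim.mul (htail.comp ha)).const_mul γ
    rw [mul_zero, mul_zero] at h
    refine h.congr' ?_
    filter_upwards [hev] with n hn
    have hm : truncatedMean μ (ζ 0) (a n) ≠ 0 := by rintro h; simp [h] at hn
    have hγ : γ ≠ 0 := by rintro rfl; simp at hn
    have hn0 := hn.2.ne'
    simp only [Function.comp_apply]
    field_simp
  · have h := hlim.mul ((tendsto_truncatedSecondMoment_div (hmeas 0) hpos htail).comp ha)
    rw [mul_zero] at h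
    refine h.congr' ?_
    filter_upwards [hev] with n hn
    have hm : truncatedMean μ (ζ 0) (a n) ≠ 0 := by rintro h; simp [h] at hn
    have hγ : γ ≠ 0 := by rintro rfl; simp at hn
    have hn0 := hn.2.ne'
    simp only [Function.comp_apply]
    field_simp
  · have h := hlim.mul_const γ
    rw [one_mul] at h
    refine h.congr' ?_
    filter_upwards [hev] with n hn
    have hγ : γ ≠ 0 := by rintro rfl; simp at hn
    field_simp

/-! ### Characteristic functions of the scaled sums -/

section CharFun

lemma charFun_map_real {Ω : Type*} [MeasurableSpace Ω] {μ : Measure Ω} {X : Ω → ℝ}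
    (hX : Measurable X) (t : ℝ) :
    charFun (μ.map X) t = ∫ ω, Complex.exp ((t * X ω : ℝ) * Complex.I) ∂μ := by
  rw [charFun_apply_real, integral_map hX.aemeasurable (by fun_prop)]
  simp only [Complex.ofReal_mul]

lemma charFun_map_scaled_sum {Ω : Type*} [MeasurableSpace Ω] {μ : Measure Ω} {ζ : ℕ → Ω → ℝ}
    (hmeas : ∀ i, Measurable (ζ i)) (hindep : iIndepFun ζ μ)
    (hident : ∀ i, IdentDistrib (ζ i) (ζ 0) μ μ) (n : ℕ)
    (a t : ℝ) :
    charFun (μ.map fun ω => (∑ i ∈ Finset.range n, ζ i ω) / a) t =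
      charFun (μ.map (ζ 0)) (t / a) ^ n := by
  have h1 : charFun (μ.map fun ω => (∑ i ∈ Finset.range n, ζ i ω) / a) t =
      charFun (μ.map fun ω => ∑ i ∈ Finset.range n, ζ i ω) (t / a) := by
    rw [charFun_map_real (by fun_prop), charFun_map_real (by fun_prop)]
    congr 1
    ext ω
    congr 3
    ring
  rw [h1, (hindep.precomp Subtype.val_injective).charFun_map_fun_finsetSum_eq_prod
      (fun i _ => (hmeas i).aemeasurable), Finset.prod_apply,
    Finset.prod_congr rfl (fun i _ => by rw [(hident i).map_eq]), Finset.prod_const,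
    Finset.card_range]

variable {Ω : Type*} [MeasurableSpace Ω] {μ : Measure Ω} [IsProbabilityMeasure μ]

lemma integrable_exp_mul_I {X : Ω → ℝ} (hX : Measurable X) :
    Integrable (fun ω => Complex.exp ((X ω : ℝ) * Complex.I)) μ :=
  Integrable.of_bound (by fun_prop) 1 (.of_forall fun ω => by rw [Complex.norm_exp_ofReal_mul_I])

/-- Closeness in probability to a constant gives closeness of the characteristic functions, with a
bound that is uniform over bounded sets of arguments. -/
lemma norm_charFun_map_sub_le {Y : Ω → ℝ} (hY : Measurable Y) (γ t : ℝ) {ε : ℝ} (hε : 0 ≤ ε) :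
    ‖charFun (μ.map Y) t - Complex.exp ((t * γ : ℝ) * Complex.I)‖ ≤
      |t| * ε + 2 * μ.real {ω | ε ≤ ‖Y ω - γ‖} := by
  set B : Set Ω := {ω | ε ≤ ‖Y ω - γ‖}
  have hB : MeasurableSet B := measurableSet_le measurable_const (by fun_prop)
  have hconst : Complex.exp ((t * γ : ℝ) * Complex.I) =
      ∫ _, Complex.exp ((t * γ : ℝ) * Complex.I) ∂μ := by simp
  rw [charFun_map_real hY, hconst, ← integral_sub (integrable_exp_mul_I (by fun_prop))
    (integrable_const _)]
  have hint : Integrable (fun ω => |t| * ε + B.indicator (fun _ => (2 : ℝ)) ω) μ :=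
    (integrable_const _).add ((integrable_const _).indicator hB)
  refine (norm_integral_le_of_norm_le hint (.of_forall fun ω => ?_)).trans (le_of_eq ?_)
  · by_cases hω : ω ∈ B
    · rw [Set.indicator_of_mem hω]
      refine (norm_sub_le _ _).trans ?_
      rw [Complex.norm_exp_ofReal_mul_I, Complex.norm_exp_ofReal_mul_I]
      have : 0 ≤ |t| * ε := by positivity
      linarith
    · rw [Set.indicator_of_notMem hω, add_zero]
      have hlt : ‖Y ω - γ‖ < ε := not_le.1 hω
      have hfac : Complex.exp ((t * Y ω : ℝ) * Complex.I) - Complex.exp ((t * γ : ℝ) * Complex.I) =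
          Complex.exp ((t * γ : ℝ) * Complex.I) *
            (Complex.exp (Complex.I * (t * (Y ω - γ) : ℝ)) - 1) := by
        rw [mul_sub, mul_one, ← Complex.exp_add]
        congr 2
        push_cast
        ring
      rw [hfac, norm_mul, Complex.norm_exp_ofReal_mul_I, one_mul]
      refine Real.norm_exp_I_mul_ofReal_sub_one_le.trans ?_
      rw [norm_mul, Real.norm_eq_abs]
      exact mul_le_mul_of_nonneg_left hlt.le (abs_nonneg t)
  · rw [integral_add (integrable_const _) ((integrable_const _).indicator hB),
      integral_indicator_const _ hB]
    simp [mul_comm]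

end CharFun

/-- A continuous path starting at `0` whose exponential stays near `1` stays near `0`: it cannot
cross the circle of radius `1 / 2`, on which the exponential is at distance at least `1 / 4`
from `1`. -/
lemma norm_le_of_norm_exp_sub_one_le {h : ℝ → ℂ} {t δ : ℝ} (hδ : δ < 1 / 4)
    (hcont : ContinuousOn h (Set.uIcc 0 t)) (h0 : h 0 = 0)
    (hexp : ∀ s ∈ Set.uIcc 0 t, ‖Complex.exp (h s) - 1‖ ≤ δ) : ‖h t‖ ≤ 2 * δ := by
  have hlow : ∀ z : ℂ, ‖z‖ ≤ 1 → ‖z‖ - ‖z‖ ^ 2 ≤ ‖Complex.exp z - 1‖ := by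
    intro z hz
    have h1 := Complex.norm_exp_sub_one_sub_id_le hz
    have h2 := norm_sub_norm_le z (Complex.exp z - 1)
    rw [norm_sub_rev z] at h2
    linarith
  have hhalf : ‖h t‖ ≤ 1 / 2 := by
    by_contra! hgt
    obtain ⟨s, hs, hs2⟩ := intermediate_value_uIcc hcont.norm
      (show (1 / 2 : ℝ) ∈ Set.uIcc ‖h 0‖ ‖h t‖ by
        rw [h0, norm_zero, Set.uIcc_of_le (norm_nonneg _)]
        exact ⟨by norm_num, hgt.le⟩)
    have h1 := hlow (h s) (by simp only at hs2; rw [hs2]; norm_num)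
    simp only at hs2
    rw [hs2] at h1
    have := hexp s hs
    norm_num at h1
    linarith
  have h1 := hlow (h t) (by linarith)
  have h2 := hexp t Set.right_mem_uIcc
  nlinarith [norm_nonneg (h t)]

/-- Taking logarithms of `φ (t / a n) ^ n → exp (iγt)`, uniformly for `t ∈ [-2, 2]`. The
continuous branch starting from `t = 0` rules out an error by multiples of `2πi`. -/
lemma eventually_norm_mul_sub_one_sub_le {φ : ℝ → ℂ} (hφ : Continuous φ) (hφ0 : φ 0 = 1)
    {a : ℕ → ℝ} (ha : Tendsto a atTop atTop) {γ : ℝ}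
    (hpow : ∀ ε, 0 < ε → ∀ᶠ n : ℕ in atTop, ∀ t ∈ Set.Icc (-2 : ℝ) 2,
      ‖φ (t / a n) ^ n - Complex.exp ((t * γ : ℝ) * Complex.I)‖ ≤ ε) {ε : ℝ} (hε : 0 < ε) :
    ∀ᶠ n : ℕ in atTop, ∀ t ∈ Set.Icc (-2 : ℝ) 2,
      ‖n * (φ (t / a n) - 1) - (t * γ : ℝ) * Complex.I‖ ≤ ε := by
  obtain ⟨r, hr, hball⟩ := Metric.continuousAt_iff.1 hφ.continuousAt (1 / 2) (by norm_num)
  obtain ⟨δ, hδ, hδε, hδ4⟩ : ∃ δ : ℝ, 0 < δ ∧ δ ≤ ε / 4 ∧ δ < 1 / 4 :=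
    ⟨min (ε / 4) (1 / 8), by positivity, min_le_left _ _, (min_le_right _ _).trans_lt (by norm_num)⟩
  set K : ℝ := 1 + 2 * |γ| with hK
  have hKpos : 0 < K := by positivity
  filter_upwards [hpow δ hδ, ha.eventually_gt_atTop (2 / r), ha.eventually_gt_atTop 0,
    tendsto_natCast_atTop_atTop.eventually_ge_atTop (K ^ 2 / (ε / 2)),
    tendsto_natCast_atTop_atTop.eventually_ge_atTop K] with n hn har ha0 hnε hnK t ht
  have hnpos : (0 : ℝ) < n := hKpos.trans_le hnK
  have hnear : ∀ s ∈ Set.Icc (-2 : ℝ) 2, ‖φ (s / a n) - 1‖ < 1 / 2 := by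
    intro s hs
    rw [← hφ0, ← dist_eq_norm]
    refine hball ?_
    rw [Real.dist_eq, sub_zero, abs_div, abs_of_pos ha0, div_lt_iff₀ ha0]
    rw [div_lt_iff₀ hr] at har
    linarith [abs_le.2 hs]
  have hslit : ∀ s ∈ Set.Icc (-2 : ℝ) 2, φ (s / a n) ∈ Complex.slitPlane := by
    intro s hs
    have := Complex.mem_slitPlane_of_norm_lt_one ((hnear s hs).trans (by norm_num))
    simpa using this
  have hsub : Set.uIcc 0 t ⊆ Set.Icc (-2 : ℝ) 2 :=
    Set.uIcc_subset_Icc ⟨by norm_num, by norm_num⟩ ht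
  have hlog := norm_le_of_norm_exp_sub_one_le (t := t) hδ4
    (h := fun s => n * Complex.log (φ (s / a n)) - (s * γ : ℝ) * Complex.I)
    (by
      refine ContinuousOn.sub (continuousOn_const.mul (ContinuousOn.clog (by fun_prop)
        fun s hs => hslit s (hsub hs))) (by fun_prop))
    (by simp [hφ0])
    (fun s hs => by
      have hs' := hsub hs
      have hne : φ (s / a n) ≠ 0 := Complex.slitPlane_ne_zero (hslit s hs')
      have h1 : Complex.exp (n * Complex.log (φ (s / a n)) - (s * γ : ℝ) * Complex.I) - 1 =
          (φ (s / a n) ^ n - Complex.exp ((s * γ : ℝ) * Complex.I)) /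
            Complex.exp ((s * γ : ℝ) * Complex.I) := by
        rw [Complex.exp_sub, Complex.exp_nat_mul, Complex.exp_log hne, sub_div,
          div_self (Complex.exp_ne_zero _)]
      rw [h1, norm_div, Complex.norm_exp_ofReal_mul_I, div_one]
      exact hn s hs')
  set w := Complex.log (φ (t / a n)) with hw
  have hexpw : Complex.exp w = φ (t / a n) :=
    Complex.exp_log (Complex.slitPlane_ne_zero (hslit t ht))
  have hI : ‖((t * γ : ℝ) : ℂ) * Complex.I‖ ≤ 2 * |γ| := by
    rw [norm_mul, Complex.norm_I, mul_one, Complex.norm_real, norm_mul, Real.norm_eq_abs,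
      Real.norm_eq_abs]
    exact mul_le_mul_of_nonneg_right (abs_le.2 ht) (abs_nonneg γ)
  -- With `n * ‖w‖` bounded, replacing `w` by `exp w - 1` costs only `O(1 / n)` after scaling.
  have hnw : n * ‖w‖ ≤ K := by
    have h1 := norm_add_le (n * w - ((t * γ : ℝ) : ℂ) * Complex.I) (((t * γ : ℝ) : ℂ) * Complex.I)
    rw [sub_add_cancel, norm_mul, Complex.norm_natCast] at h1
    linarith
  have hw1 : ‖w‖ ≤ 1 := by
    refine le_of_mul_le_mul_left ?_ hnpos
    linarith
  have hquad := Complex.norm_exp_sub_one_sub_id_le hw1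
  rw [hexpw] at hquad
  have hnquad : n * ‖φ (t / a n) - 1 - w‖ ≤ ε / 2 := by
    have h1 : n * (n * ‖φ (t / a n) - 1 - w‖) ≤ n * (ε / 2) := by
      rw [div_le_iff₀ (by positivity)] at hnε
      calc n * (n * ‖φ (t / a n) - 1 - w‖) ≤ n * (n * ‖w‖ ^ 2) := by gcongr
        _ = (n * ‖w‖) ^ 2 := by ring
        _ ≤ K ^ 2 := by gcongr
        _ ≤ n * (ε / 2) := hnε
    exact le_of_mul_le_mul_left h1 hnpos
  calc ‖n * (φ (t / a n) - 1) - (t * γ : ℝ) * Complex.I‖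
      = ‖n * (φ (t / a n) - 1 - w) + (n * w - (t * γ : ℝ) * Complex.I)‖ := by congr 1; ring
    _ ≤ n * ‖φ (t / a n) - 1 - w‖ + ‖n * w - (t * γ : ℝ) * Complex.I‖ := by
        refine (norm_add_le _ _).trans ?_
        rw [norm_mul, Complex.norm_natCast]
    _ ≤ ε := by linarith

/-! ### Truncated moments in terms of the characteristic function -/

section Truncation

variable {Ω : Type*} [MeasurableSpace Ω] {μ : Measure Ω} [IsProbabilityMeasure μ] {X : Ω → ℝ}

lemma re_charFun_map (hX : Measurable X) (t : ℝ) :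
    (charFun (μ.map X) t).re = ∫ ω, Real.cos (t * X ω) ∂μ := by
  rw [charFun_map_real hX]
  refine (integral_re (integrable_exp_mul_I (by fun_prop))).symm.trans ?_
  simp only [RCLike.re_to_complex, Complex.exp_ofReal_mul_I_re]

lemma im_charFun_map (hX : Measurable X) (t : ℝ) :
    (charFun (μ.map X) t).im = ∫ ω, Real.sin (t * X ω) ∂μ := by
  rw [charFun_map_real hX]
  refine (integral_im (integrable_exp_mul_I (by fun_prop))).symm.trans ?_
  simp only [RCLike.im_to_complex, Complex.exp_ofReal_mul_I_im]

lemma truncatedSecondMoment_div_sq_le (hX : Measurable X) {a : ℝ} (ha : 0 < a) :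
    truncatedSecondMoment μ X a / a ^ 2 ≤
      Real.pi ^ 2 / 2 * (1 - (charFun (μ.map X) (1 / a)).re) := by
  have hcos : Integrable (fun ω => Real.cos (1 / a * X ω)) μ :=
    Integrable.of_bound (by fun_prop) 1 (.of_forall fun ω => Real.abs_cos_le_one _)
  have h1 : 1 - (charFun (μ.map X) (1 / a)).re = ∫ ω, (1 - Real.cos (1 / a * X ω)) ∂μ := by
    rw [re_charFun_map hX, integral_sub (integrable_const _) hcos]
    simp
  rw [h1, ← integral_const_mul, truncatedSecondMoment, ← integral_div,
    ← integral_indicator (measurableSet_abs_le hX a)]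
  refine integral_mono ((integrable_indicator_iff (measurableSet_abs_le hX a)).2
    ((integrableOn_sq_abs_le hX a).div_const _))
    (((integrable_const _).sub hcos).const_mul _) fun ω => ?_
  by_cases hω : |X ω| ≤ a
  · rw [Set.indicator_of_mem (show ω ∈ {ω | |X ω| ≤ a} from hω)]
    have hx : |1 / a * X ω| ≤ 1 := by
      rw [one_div_mul_eq_div, abs_div, abs_of_pos ha]
      exact (div_le_one ha).2 hω
    have h2 := Real.cos_le_one_sub_mul_cos_sq (hx.trans (by linarith [Real.pi_gt_three]))
    have h3 : X ω ^ 2 / a ^ 2 =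
        Real.pi ^ 2 / 2 * (2 / Real.pi ^ 2 * (1 / a * X ω) ^ 2) := by
      have := Real.pi_ne_zero
      field_simp
    simp only [h3]
    exact mul_le_mul_of_nonneg_left (by linarith) (by positivity)
  · rw [Set.indicator_of_notMem (show ω ∉ {ω | |X ω| ≤ a} from hω)]
    exact mul_nonneg (by positivity) (by linarith [Real.cos_le_one (1 / a * X ω)])

lemma abs_sin_sub_self_le_sq (x : ℝ) (hx : |x| ≤ 1) : |Real.sin x - x| ≤ x ^ 2 := by
  rw [abs_sub_comm, ← sq_abs]
  refine (Real.abs_sub_sin_le x).trans ?_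
  have := abs_nonneg x
  nlinarith [pow_le_pow_of_le_one this hx (show 2 ≤ 3 by norm_num), sq_nonneg |x|]

lemma abs_im_charFun_sub_truncatedMean_le (hX : Measurable X) {a : ℝ} (ha : 0 < a) :
    |(charFun (μ.map X) (1 / a)).im - truncatedMean μ X a / a| ≤
      truncatedSecondMoment μ X a / a ^ 2 + μ.real {ω | a < |X ω|} := by
  have hsin : Integrable (fun ω => Real.sin (1 / a * X ω)) μ :=
    Integrable.of_bound (by fun_prop) 1 (.of_forall fun ω => Real.abs_sin_le_one _)
  have hmS := measurableSet_abs_le hX a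
  have hm1 := (integrable_indicator_iff hmS).2 ((integrableOn_abs_le (μ := μ) hX a).div_const a)
  have hm2 := (integrable_indicator_iff hmS).2
    ((integrableOn_sq_abs_le (μ := μ) hX a).div_const (a ^ 2))
  have hm3 := (integrable_const (μ := μ) (1 : ℝ)).indicator (measurableSet_lt_abs hX a)
  have htail : μ.real {ω | a < |X ω|} =
      ∫ ω, Set.indicator {ω | a < |X ω|} (fun _ => (1 : ℝ)) ω ∂μ := by
    rw [integral_indicator_const _ (measurableSet_lt_abs hX a)]; simp
  rw [htail, truncatedMean, truncatedSecondMoment, ← integral_div, ← integral_div,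
    ← integral_indicator hmS, ← integral_indicator hmS, im_charFun_map hX, ← integral_add hm2 hm3,
    ← integral_sub hsin hm1, ← Real.norm_eq_abs]
  refine norm_integral_le_of_norm_le (hm2.add hm3) (.of_forall fun ω => ?_)
  rw [Real.norm_eq_abs]
  by_cases hω : |X ω| ≤ a
  · rw [Set.indicator_of_mem (show ω ∈ {ω | |X ω| ≤ a} from hω),
      Set.indicator_of_mem (show ω ∈ {ω | |X ω| ≤ a} from hω),
      Set.indicator_of_notMem (show ω ∉ {ω | a < |X ω|} from not_lt.2 hω), add_zero,
      one_div_mul_eq_div, ← div_pow]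
    refine abs_sin_sub_self_le_sq _ ?_
    rw [abs_div, abs_of_pos ha]
    exact (div_le_one ha).2 hω
  · rw [Set.indicator_of_notMem (show ω ∉ {ω | |X ω| ≤ a} from hω),
      Set.indicator_of_notMem (show ω ∉ {ω | |X ω| ≤ a} from hω),
      Set.indicator_of_mem (show ω ∈ {ω | a < |X ω|} from not_le.1 hω), sub_zero, zero_add]
    exact Real.abs_sin_le_one _

/-- The odd limit `iγt` integrates to zero over `[-2, 2]`, so it does not contribute to the tail
bound. -/
lemma mul_measureReal_lt_abs_le (hX : Measurable X) {a γ ε : ℝ} (ha : 0 < a) (n : ℕ)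
    (h : ∀ t ∈ Set.Icc (-2 : ℝ) 2,
      ‖n * (charFun (μ.map X) (t / a) - 1) - (t * γ : ℝ) * Complex.I‖ ≤ ε) :
    n * μ.real {ω | a < |X ω|} ≤ 2 * ε := by
  have hXa : Measurable fun ω => X ω / a := hX.div_const a
  have : IsProbabilityMeasure (μ.map fun ω => X ω / a) :=
    Measure.isProbabilityMeasure_map hXa.aemeasurable
  have hchar : ∀ t, charFun (μ.map fun ω => X ω / a) t = charFun (μ.map X) (t / a) := by
    intro t
    rw [charFun_map_real hXa, charFun_map_real hX]
    congr 1
    ext ω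
    congr 3
    ring
  have h1 := measureReal_abs_gt_le_integral_charFun (μ := μ.map fun ω => X ω / a)
    (r := 1) one_pos
  rw [map_measureReal_apply hXa (measurableSet_lt measurable_const (by fun_prop))] at h1
  have hset : (fun ω => X ω / a) ⁻¹' {x : ℝ | 1 < |x|} = {ω | a < |X ω|} := by
    ext ω
    simp only [Set.mem_preimage, Set.mem_ofPred_eq, abs_div, abs_of_pos ha]
    rw [one_lt_div ha]
  rw [hset] at h1
  norm_num only at h1
  have hodd : ∫ t in (-2 : ℝ)..2, ((t * γ : ℝ) : ℂ) * Complex.I = 0 := by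
    rw [intervalIntegral.integral_mul_const, intervalIntegral.integral_ofReal,
      intervalIntegral.integral_mul_const, integral_id]
    norm_num
  have hint1 : IntervalIntegrable (fun t => 1 - charFun (μ.map fun ω => X ω / a) t) volume
      (-2) 2 :=
    intervalIntegrable_const.sub intervalIntegrable_charFun
  have hint2 : IntervalIntegrable (fun t : ℝ => ((t * γ : ℝ) : ℂ) * Complex.I) volume (-2) 2 :=
    Continuous.intervalIntegrable (by fun_prop) _ _
  have hEq : (n : ℂ) * ∫ t in (-2 : ℝ)..2, 1 - charFun (μ.map fun ω => X ω / a) t =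
      ∫ t in (-2 : ℝ)..2, (n * (1 - charFun (μ.map fun ω => X ω / a) t) +
        ((t * γ : ℝ) : ℂ) * Complex.I) := by
    rw [intervalIntegral.integral_add (hint1.const_mul _) hint2, hodd, add_zero,
      intervalIntegral.integral_const_mul]
  have h2 : ‖(n : ℂ) * ∫ t in (-2 : ℝ)..2, 1 - charFun (μ.map fun ω => X ω / a) t‖ ≤
      ε * |2 - (-2)| := by
    rw [hEq]
    refine intervalIntegral.norm_integral_le_of_norm_le_const fun t ht => ?_
    rw [Set.uIoc_of_le (by norm_num)] at ht
    have h3 := h t ⟨ht.1.le, ht.2⟩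
    rw [← norm_neg] at h3
    refine le_of_eq_of_le ?_ h3
    rw [hchar]
    congr 1
    ring
  rw [norm_mul, Complex.norm_natCast] at h2
  norm_num at h2
  have h4 := mul_le_mul_of_nonneg_left h1 (n.cast_nonneg : (0 : ℝ) ≤ n)
  linarith

end Truncation

/-! ### Necessity -/

section Necessity

variable {Ω : Type*} [MeasurableSpace Ω] {μ : Measure Ω} [IsProbabilityMeasure μ] {ζ : ℕ → Ω → ℝ}
  {a : ℕ → ℝ} {γ : ℝ}

lemma ScaledSumsTendsto.eventually_norm_charFun_pow_sub_le (h : ScaledSumsTendsto μ ζ a γ)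
    (hmeas : ∀ i, Measurable (ζ i)) (hindep : iIndepFun ζ μ)
    (hident : ∀ i, IdentDistrib (ζ i) (ζ 0) μ μ) {ε : ℝ} (hε : 0 < ε) :
    ∀ᶠ n : ℕ in atTop, ∀ t ∈ Set.Icc (-2 : ℝ) 2,
      ‖charFun (μ.map (ζ 0)) (t / a n) ^ n - Complex.exp ((t * γ : ℝ) * Complex.I)‖ ≤ ε := by
  have hlim := tendstoInMeasure_iff_measureReal_norm.1 h.2 (ε / 4) (by positivity)
  filter_upwards [hlim.eventually_lt_const (show (0 : ℝ) < ε / 4 by positivity)] with n hn t ht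
  rw [← charFun_map_scaled_sum hmeas hindep hident]
  refine (norm_charFun_map_sub_le (by fun_prop) γ t (show 0 ≤ ε / 4 by positivity)).trans ?_
  have : |t| * (ε / 4) ≤ 2 * (ε / 4) :=
    mul_le_mul_of_nonneg_right (abs_le.2 ht) (by positivity)
  linarith

/-- The accompanying exponents `n (φ(t / a n) - 1)` converge to `iγt`, uniformly on `[-2, 2]`. -/
lemma ScaledSumsTendsto.eventually_norm_charFun_sub_one_le (h : ScaledSumsTendsto μ ζ a γ)
    (hmeas : ∀ i, Measurable (ζ i)) (hindep : iIndepFun ζ μ)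
    (hident : ∀ i, IdentDistrib (ζ i) (ζ 0) μ μ) {ε : ℝ} (hε : 0 < ε) :
    ∀ᶠ n : ℕ in atTop, ∀ t ∈ Set.Icc (-2 : ℝ) 2,
      ‖n * (charFun (μ.map (ζ 0)) (t / a n) - 1) - (t * γ : ℝ) * Complex.I‖ ≤ ε := by
  have : IsProbabilityMeasure (μ.map (ζ 0)) :=
    Measure.isProbabilityMeasure_map (hmeas 0).aemeasurable
  exact eventually_norm_mul_sub_one_sub_le continuous_charFun (by simp) h.1
    (fun δ hδ => h.eventually_norm_charFun_pow_sub_le hmeas hindep hident hδ) hε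

lemma ScaledSumsTendsto.tendsto_mul_measureReal (h : ScaledSumsTendsto μ ζ a γ)
    (hmeas : ∀ i, Measurable (ζ i)) (hindep : iIndepFun ζ μ)
    (hident : ∀ i, IdentDistrib (ζ i) (ζ 0) μ μ) :
    Tendsto (fun n : ℕ => n * μ.real {ω | a n < |ζ 0 ω|}) atTop (𝓝 0) := by
  rw [tendsto_order]
  refine ⟨fun b hb => .of_forall fun n => hb.trans_le (by positivity), fun b hb => ?_⟩
  filter_upwards [h.eventually_norm_charFun_sub_one_le hmeas hindep hident
    (show 0 < b / 4 by positivity), h.1.eventually_gt_atTop 0] with n hn hn0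
  have := mul_measureReal_lt_abs_le (hmeas 0) hn0 n hn
  linarith

lemma ScaledSumsTendsto.tendsto_truncatedSecondMoment (h : ScaledSumsTendsto μ ζ a γ)
    (hmeas : ∀ i, Measurable (ζ i)) (hindep : iIndepFun ζ μ)
    (hident : ∀ i, IdentDistrib (ζ i) (ζ 0) μ μ) :
    Tendsto (fun n : ℕ => n * (truncatedSecondMoment μ (ζ 0) (a n) / a n ^ 2)) atTop (𝓝 0) := by
  rw [tendsto_order]
  refine ⟨fun b hb => .of_forall fun n => hb.trans_le (mul_nonneg n.cast_nonneg
    (div_nonneg (truncatedSecondMoment_nonneg _ _) (sq_nonneg _))), fun b hb => ?_⟩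
  have hπ : 0 < Real.pi ^ 2 / 2 := by positivity
  filter_upwards [h.eventually_norm_charFun_sub_one_le hmeas hindep hident
    (show 0 < b / 2 / (Real.pi ^ 2 / 2) by positivity), h.1.eventually_gt_atTop 0] with n hn hn0
  have h1 := mul_le_mul_of_nonneg_left (truncatedSecondMoment_div_sq_le (μ := μ) (hmeas 0) hn0)
    (n.cast_nonneg : (0 : ℝ) ≤ n)
  have h2 := (Complex.abs_re_le_norm _).trans (hn 1 ⟨by norm_num, by norm_num⟩)
  rw [le_div_iff₀ hπ] at h2
  have h3 : ((n : ℂ) * (charFun (μ.map (ζ 0)) (1 / a n) - 1) - ((1 * γ : ℝ) : ℂ) * Complex.I).re =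
      -(n * (1 - (charFun (μ.map (ζ 0)) (1 / a n)).re)) := by
    simp; ring
  rw [h3, abs_neg] at h2
  have h4 := mul_le_mul_of_nonneg_right
    (le_abs_self (n * (1 - (charFun (μ.map (ζ 0)) (1 / a n)).re))) hπ.le
  linarith

/-- The truncated mean determines the norming constants. -/
lemma ScaledSumsTendsto.tendsto_truncatedMean (h : ScaledSumsTendsto μ ζ a γ)
    (hmeas : ∀ i, Measurable (ζ i)) (hindep : iIndepFun ζ μ)
    (hident : ∀ i, IdentDistrib (ζ i) (ζ 0) μ μ) :
    Tendsto (fun n : ℕ => n * (truncatedMean μ (ζ 0) (a n) / a n)) atTop (𝓝 γ) := by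
  have hsum := (h.tendsto_truncatedSecondMoment hmeas hindep hident).add
    (h.tendsto_mul_measureReal hmeas hindep hident)
  rw [add_zero] at hsum
  rw [Metric.tendsto_nhds]
  intro ε hε
  filter_upwards [h.eventually_norm_charFun_sub_one_le hmeas hindep hident
    (show 0 < ε / 2 by positivity), h.1.eventually_gt_atTop 0,
    hsum.eventually_lt_const (show 0 < ε / 2 by positivity)] with n hn hn0 hs
  have h1 := mul_le_mul_of_nonneg_left
    (abs_im_charFun_sub_truncatedMean_le (μ := μ) (hmeas 0) hn0) (n.cast_nonneg : (0 : ℝ) ≤ n)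
  rw [← abs_of_nonneg (n.cast_nonneg : (0 : ℝ) ≤ n), ← abs_mul,
    abs_of_nonneg (n.cast_nonneg : (0 : ℝ) ≤ n), mul_sub] at h1
  have h2 := (Complex.abs_im_le_norm _).trans (hn 1 ⟨by norm_num, by norm_num⟩)
  have h3 : ((n : ℂ) * (charFun (μ.map (ζ 0)) (1 / a n) - 1) - ((1 * γ : ℝ) : ℂ) * Complex.I).im =
      n * (charFun (μ.map (ζ 0)) (1 / a n)).im - γ := by
    simp
  rw [h3] at h2
  rw [Real.dist_eq]
  have h4 := abs_sub_le (n * (truncatedMean μ (ζ 0) (a n) / a n))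
    (n * (charFun (μ.map (ζ 0)) (1 / a n)).im) γ
  rw [abs_sub_comm (n * (truncatedMean μ (ζ 0) (a n) / a n))
    (n * (charFun (μ.map (ζ 0)) (1 / a n)).im)] at h4
  linarith

lemma tendsto_measureReal_le_abs {X : Ω → ℝ} (hX : Measurable X) :
    Tendsto (fun x : ℝ => μ.real {ω | x ≤ |X ω|}) atTop (𝓝 0) := by
  have hanti : Antitone fun x : ℝ => {ω | x ≤ |X ω|} := fun x y hxy ω (hω : y ≤ |X ω|) =>
    hxy.trans hω
  have h := tendsto_measure_iInter_atTop (μ := μ) (s := fun x : ℝ => {ω | x ≤ |X ω|})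
    (fun x => (measurableSet_le measurable_const (by fun_prop)).nullMeasurableSet) hanti
    ⟨0, measure_ne_top _ _⟩
  have hempty : (⋂ x : ℝ, {ω | x ≤ |X ω|}) = ∅ := by
    ext ω
    simp only [Set.mem_iInter, Set.mem_ofPred_eq, Set.mem_empty_iff_false, iff_false, not_forall,
      not_le]
    exact ⟨|X ω| + 1, lt_add_one _⟩
  rw [hempty, measure_empty] at h
  exact (ENNReal.tendsto_toReal ENNReal.zero_ne_top).comp h

/-- A single summand is negligible against `a n`, so consecutive norming constants are comparable.
This lets statements along the sequence `a` be transferred to all large real arguments. -/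
lemma ScaledSumsTendsto.eventually_succ_le (h : ScaledSumsTendsto μ ζ a γ) (hγ : γ ≠ 0)
    (hmeas : ∀ i, Measurable (ζ i)) (hident : ∀ i, IdentDistrib (ζ i) (ζ 0) μ μ) :
    ∀ᶠ n : ℕ in atTop, a (n + 1) ≤ 2 * a n := by
  have hγ' : 0 < |γ| := abs_pos.2 hγ
  have hε : 0 < |γ| / 4 := by positivity
  have hlim := tendstoInMeasure_iff_measureReal_norm.1 h.2 (|γ| / 4) hε
  have hsingle := (tendsto_measureReal_le_abs (μ := μ) (hmeas 0)).comp (h.1.const_mul_atTop hε)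
  have hthird : (0 : ℝ) < 1 / 3 := by norm_num
  filter_upwards [hlim.eventually_lt_const hthird,
    ((tendsto_add_atTop_iff_nat 1).2 hlim).eventually_lt_const hthird,
    hsingle.eventually_lt_const hthird, h.1.eventually_gt_atTop 0,
    ((tendsto_add_atTop_iff_nat 1).2 h.1).eventually_gt_atTop 0] with n h1 h2 h3 hn hn1
  -- The three bad events have total probability less than `1`, so some `ω` avoids them all.
  obtain ⟨ω, hω⟩ : ∃ ω, ω ∉ {ω | |γ| / 4 ≤ ‖(∑ i ∈ Finset.range n, ζ i ω) / a n - γ‖} ∪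
      {ω | |γ| / 4 ≤ ‖(∑ i ∈ Finset.range (n + 1), ζ i ω) / a (n + 1) - γ‖} ∪
      {ω | |γ| / 4 * a n ≤ |ζ n ω|} := by
    by_contra! hall
    have huniv := Set.eq_univ_of_forall hall
    have hident' : μ.real {ω | |γ| / 4 * a n ≤ |ζ n ω|} = μ.real {ω | |γ| / 4 * a n ≤ |ζ 0 ω|} :=
      congrArg ENNReal.toReal ((hident n).measure_mem_eq (s := {x : ℝ | |γ| / 4 * a n ≤ |x|})
        (measurableSet_le measurable_const (by fun_prop)))
    have h4 := congrArg μ.real huniv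
    rw [probReal_univ] at h4
    have h5 := measureReal_union_le (μ := μ)
      ({ω | |γ| / 4 ≤ ‖(∑ i ∈ Finset.range n, ζ i ω) / a n - γ‖} ∪
        {ω | |γ| / 4 ≤ ‖(∑ i ∈ Finset.range (n + 1), ζ i ω) / a (n + 1) - γ‖})
      {ω | |γ| / 4 * a n ≤ |ζ n ω|}
    have h6 := measureReal_union_le (μ := μ)
      {ω | |γ| / 4 ≤ ‖(∑ i ∈ Finset.range n, ζ i ω) / a n - γ‖}
      {ω | |γ| / 4 ≤ ‖(∑ i ∈ Finset.range (n + 1), ζ i ω) / a (n + 1) - γ‖}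
    simp only [Function.comp_apply] at h3
    linarith
  simp only [Set.mem_union, Set.mem_ofPred_eq, not_or, not_le, Real.norm_eq_abs] at hω
  obtain ⟨⟨hω1, hω2⟩, hω3⟩ := hω
  rw [div_sub' hn.ne', abs_div, abs_of_pos hn, div_lt_iff₀ hn] at hω1
  rw [div_sub' hn1.ne', abs_div, abs_of_pos hn1, div_lt_iff₀ hn1, Finset.sum_range_succ] at hω2
  generalize (∑ i ∈ Finset.range n, ζ i ω) = S at *
  have h4 : a (n + 1) * |γ| ≤
      |S + ζ n ω - a (n + 1) * γ| + |S - a n * γ| + a n * |γ| + |ζ n ω| := by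
    rw [← abs_of_pos hn1, ← abs_mul, ← abs_of_pos hn, ← abs_mul, abs_of_pos hn1, abs_of_pos hn]
    rcases abs_cases (a (n + 1) * γ) with h | h <;>
    rcases abs_cases (S + ζ n ω - a (n + 1) * γ) with h' | h' <;>
    linarith [neg_abs_le (S - a n * γ), le_abs_self (S - a n * γ), neg_abs_le (a n * γ),
      le_abs_self (a n * γ), neg_abs_le (ζ n ω), le_abs_self (ζ n ω)]
  have h5 : |γ| * a (n + 1) ≤ |γ| * (2 * a n) := by linarith
  exact le_of_mul_le_mul_left h5 hγ'

/-- A bound for `x P(|X| > x)` against the truncated mean passes from a point `x₀` to every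
`x ∈ [x₀, 2 x₀]`, at the cost of a constant factor. -/
lemma truncatedMean_div_pos_and_tail_le {X : Ω → ℝ} (hX : Measurable X) {x₀ x δ : ℝ}
    (hx₀ : 0 < x₀) (hx : x ∈ Set.Icc x₀ (2 * x₀)) (hδ : δ ≤ 1 / 4)
    (hm : 0 < truncatedMean μ X x₀ / γ)
    (htail : x₀ * μ.real {ω | x₀ < |X ω|} ≤ δ * |truncatedMean μ X x₀|) :
    0 < truncatedMean μ X x / γ ∧
      x * μ.real {ω | x < |X ω|} / |truncatedMean μ X x| ≤ 4 * δ := by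
  have hγ : 0 < |γ| := abs_pos.2 (by rintro rfl; simp at hm)
  have hm0 : 0 < |truncatedMean μ X x₀| := abs_pos.2 (by rintro h; simp [h] at hm)
  have h1 := abs_truncatedMean_sub_le (μ := μ) hX hx₀.le hx.1
  have h2 := mul_le_mul_of_nonneg_right hx.2 (measureReal_nonneg (μ := μ) (s := {ω | x₀ < |X ω|}))
  have h3 : μ.real {ω | x < |X ω|} ≤ μ.real {ω | x₀ < |X ω|} :=
    measureReal_mono fun ω (hω : x < |X ω|) => hx.1.trans_lt hω
  have h4 := mul_le_mul_of_nonneg_left h3 (hx₀.le.trans hx.1)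
  have hδm := mul_le_mul_of_nonneg_right hδ hm0.le
  have hdiff : |truncatedMean μ X x - truncatedMean μ X x₀| ≤ |truncatedMean μ X x₀| / 2 := by
    linarith
  have hlow : |truncatedMean μ X x₀| / 2 ≤ |truncatedMean μ X x| := by
    have := abs_sub_abs_le_abs_sub (truncatedMean μ X x₀) (truncatedMean μ X x)
    rw [abs_sub_comm] at this
    linarith
  constructor
  · have h5 : |truncatedMean μ X x / γ - truncatedMean μ X x₀ / γ| ≤
        truncatedMean μ X x₀ / γ / 2 := by
      rw [← sub_div, abs_div, ← abs_of_pos hm, abs_div, div_right_comm]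
      gcongr
    linarith [(abs_le.1 h5).1]
  · have hδ0 : 0 ≤ δ := by
      have h6 : 0 ≤ x₀ * μ.real {ω | x₀ < |X ω|} := by positivity
      exact nonneg_of_mul_nonneg_left (h6.trans htail) hm0
    rw [div_le_iff₀ (lt_of_lt_of_le (by positivity) hlow)]
    have := mul_le_mul_of_nonneg_left hlow hδ0
    linarith

lemma ScaledSumsTendsto.eventually_and_tendsto (h : ScaledSumsTendsto μ ζ a γ) (hγ : γ ≠ 0)
    (hmeas : ∀ i, Measurable (ζ i)) (hindep : iIndepFun ζ μ)
    (hident : ∀ i, IdentDistrib (ζ i) (ζ 0) μ μ) :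
    (∀ᶠ x : ℝ in atTop, 0 < truncatedMean μ (ζ 0) x / γ) ∧
      Tendsto (fun x : ℝ => x * μ.real {ω | x < |ζ 0 ω|} / truncatedMean μ (ζ 0) x)
        atTop (𝓝 0) := by
  have hmean := h.tendsto_truncatedMean hmeas hindep hident
  have hratio : Tendsto (fun n : ℕ => n * (truncatedMean μ (ζ 0) (a n) / a n) / γ) atTop (𝓝 1) := by
    simpa [hγ] using hmean.div_const γ
  have hquot := (h.tendsto_mul_measureReal hmeas hindep hident).div hmean hγ
  rw [zero_div] at hquot
  -- Every large `x` lies in `[a n, 2 * a n]` for some large `n`.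
  have key : ∀ δ : ℝ, 0 < δ → δ ≤ 1 / 4 → ∀ᶠ x : ℝ in atTop, 0 < truncatedMean μ (ζ 0) x / γ ∧
      x * μ.real {ω | x < |ζ 0 ω|} / |truncatedMean μ (ζ 0) x| ≤ 4 * δ := by
    intro δ hδ hδ4
    obtain ⟨N, hN⟩ := eventually_atTop.1 ((hratio.eventually_const_lt one_pos).and
      ((hquot.abs.eventually_lt_const (show |(0 : ℝ)| < δ by simpa using hδ)).and
        ((h.1.eventually_gt_atTop 0).and ((h.eventually_succ_le hγ hmeas hident).and
          (eventually_gt_atTop 0)))))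
    filter_upwards [eventually_ge_atTop (a N)] with x hx
    obtain ⟨n, hnN, hn, hn1⟩ : ∃ n, N ≤ n ∧ a n ≤ x ∧ x < a (n + 1) := by
      by_contra! hcon
      have hall : ∀ n, N ≤ n → a n ≤ x := fun n hn => Nat.le_induction hx
        (fun k hk ih => hcon k hk ih) n hn
      obtain ⟨n, hn⟩ := ((h.1.eventually_gt_atTop x).and (eventually_ge_atTop N)).exists
      exact absurd (hall n hn.2) (not_le.2 hn.1)
    obtain ⟨h1, h2, h3, h4, h5⟩ := hN n hnN
    have hnpos : (0 : ℝ) < n := Nat.cast_pos.2 h5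
    have hm : 0 < truncatedMean μ (ζ 0) (a n) / γ := by
      have h6 : n * (truncatedMean μ (ζ 0) (a n) / a n) / γ =
          n / a n * (truncatedMean μ (ζ 0) (a n) / γ) := by ring
      rw [h6] at h1
      exact pos_of_mul_pos_right h1 (by positivity)
    have hm0 : truncatedMean μ (ζ 0) (a n) ≠ 0 := by rintro h; simp [h] at hm
    refine truncatedMean_div_pos_and_tail_le (hmeas 0) h3 ⟨hn, hn1.le.trans h4⟩ hδ4 hm ?_
    have h7 : n * μ.real {ω | a n < |ζ 0 ω|} / (n * (truncatedMean μ (ζ 0) (a n) / a n)) =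
        a n * μ.real {ω | a n < |ζ 0 ω|} / truncatedMean μ (ζ 0) (a n) := by
      field_simp
    rw [Pi.div_apply, h7, abs_div, div_lt_iff₀ (abs_pos.2 hm0)] at h2
    exact (le_abs_self _).trans h2.le
  refine ⟨(key (1 / 4) (by norm_num) le_rfl).mono fun x hx => hx.1, ?_⟩
  rw [Metric.tendsto_nhds]
  intro ε hε
  filter_upwards [key (min (ε / 8) (1 / 4)) (by positivity) (min_le_right _ _),
    eventually_ge_atTop 0] with x hx hx0
  rw [Real.dist_eq, sub_zero, abs_div, abs_of_nonneg (by positivity)]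
  have := min_le_left (ε / 8) (1 / 4)
  linarith [hx.2]

lemma ScaledSumsTendsto.isEquivalent (h : ScaledSumsTendsto μ ζ a γ) (hγ : γ ≠ 0)
    (hmeas : ∀ i, Measurable (ζ i)) (hindep : iIndepFun ζ μ)
    (hident : ∀ i, IdentDistrib (ζ i) (ζ 0) μ μ) :
    (fun n : ℕ => a n / truncatedMean μ (ζ 0) (a n)) ~[atTop] (fun n : ℕ => (n : ℝ) / γ) := by
  have hne : ∀ᶠ n : ℕ in atTop, (n : ℝ) / γ ≠ 0 := by
    filter_upwards [eventually_gt_atTop 0] with n hn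
    exact div_ne_zero (Nat.cast_ne_zero.2 hn.ne') hγ
  rw [isEquivalent_iff_tendsto_one hne]
  have hlim := (h.tendsto_truncatedMean hmeas hindep hident).inv₀ hγ |>.const_mul γ
  rw [mul_inv_cancel₀ hγ] at hlim
  refine hlim.congr fun n => ?_
  simp only [Pi.div_apply, div_eq_mul_inv, mul_inv, inv_inv]
  ring

end Necessity

/-! ### The criterion -/

theorem mainTheorem8 {Ω : Type*} [MeasurableSpace Ω] (μ : Measure Ω) [IsProbabilityMeasure μ]
    (ζ : ℕ → Ω → ℝ) (hmeas : ∀ i, Measurable (ζ i)) (hindep : iIndepFun ζ μ)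
    (hident : ∀ i, IdentDistrib (ζ i) (ζ 0) μ μ) (γ : ℝ) (hγ : γ ≠ 0) :
    ((∃ a : ℕ → ℝ, ScaledSumsTendsto μ ζ a γ) ↔
      ((∀ᶠ x : ℝ in atTop, 0 < truncatedMean μ (ζ 0) x / γ) ∧
        Tendsto (fun x : ℝ => x * μ.real {ω | x < |ζ 0 ω|} / truncatedMean μ (ζ 0) x)
          atTop (𝓝 0))) ∧
    (∀ a : ℕ → ℝ, ScaledSumsTendsto μ ζ a γ →
      (fun n : ℕ => a n / truncatedMean μ (ζ 0) (a n)) ~[atTop] (fun n : ℕ => (n : ℝ) / γ)) :=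
  ⟨⟨fun ⟨_, ha⟩ => ha.eventually_and_tendsto hγ hmeas hindep hident,
    fun ⟨hpos, htail⟩ => exists_scaledSumsTendsto hmeas hindep hident hpos htail⟩,
    fun _ ha => ha.isEquivalent hγ hmeas hindep hident⟩
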